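/- Let $n\ge 0$ be an integer, let $\mathcal J_m=\begin{bmatrix}0&I_m\\-I_m&0\end{bmatrix}\in\mathbb C^{2m\times 2m}$ for $m\ge 0$, and let ${}^H$ denote the conjugate transpose. Let $\mathcal M,\mathcal L\in\mathbb C^{2n\times 2n}$ be such that - $(\mathcal M,\mathcal L)$ is a symplectic pair, that is, $\mathcal M\mathcal J_n\mathcal M^H=\mathcal L\mathcal J_n\mathcal L^H$; - $(\mathcal M,\mathcal L)$ is regular, that is, $\det(\mathcal M-\lambda\mathcal L)\ne 0$ for some $\lambda\in\mathbb C$; - $\mathrm{ind}_\infty(\mathcal M,\mathcal L)\le 1$. Here $\mathrm{ind}_\infty(A,B)$, for a regular pair $(A,B)$, is the least $\nu\ge 0$ with $N^\nu=0$, where $N$ is the nilpotent block of a Kronecker canonical form $PAQ=\begin{bmatrix}J&0\\0&I\end{bmatrix}$, $PBQ=\begin{bmatrix}I&0\\0&N\end{bmatrix}$ with $P,Q$ invertible; it is $0$ if $B$ is invertible. Then there is an integer $\hat n$ with $0\le\hat n\le n$ such that $\operatorname{rank}\mathcal M=\operatorname{rank}\mathcal L=n+\hat n$. In addition, with $\ell=n-\hat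 n$, there exist $U_0,U_\infty\in\mathbb C^{2n\times\ell}$, $U_1\in\mathbb C^{2n\times 2\hat n}$ and a symplectic matrix $\widehat{\mathcal S}\in\mathbb C^{2\hat n\times 2\hat n}$ (that is, $\widehat{\mathcal S}\mathcal J_{\hat n}\widehat{\mathcal S}^H=\mathcal J_{\hat n}$) such that, with $\mathbf U=[\,U_1\mid U_0,U_\infty\,]$, $$\mathbf U^H\mathcal J_n\mathbf U=\begin{bmatrix}\mathcal J_{\hat n}&0\\0&\mathcal J_\ell\end{bmatrix}$$ and $$\mathcal M U_0=0,\qquad \mathcal L U_\infty=0,\qquad \mathcal M U_1=\mathcal L U_1\widehat{\mathcal S}.$$ -/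

import Mathlib

open scoped Matrix

/-- The matrix `[0, Iₙ; -Iₙ, 0]`; a `2n × 2n` matrix is indexed by `Fin n ⊕ Fin n`. (It is the
negative of Mathlib's `Matrix.J (Fin n) ℂ`.) -/
def SymplecticPair.J (n : ℕ) : Matrix (Fin n ⊕ Fin n) (Fin n ⊕ Fin n) ℂ :=
  Matrix.fromBlocks 0 1 (-1) 0

/-- `S` is (conjugate) symplectic: `S J Sᴴ = J`. -/
def IsSymplecticMatrix {n : ℕ} (S : Matrix (Fin n ⊕ Fin n) (Fin n ⊕ Fin n) ℂ) : Prop :=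
  S * SymplecticPair.J n * Sᴴ = SymplecticPair.J n

/-- `(M, L)` is a symplectic pair: `M J Mᴴ = L J Lᴴ`. -/
def IsSymplecticPair {n : ℕ} (M L : Matrix (Fin n ⊕ Fin n) (Fin n ⊕ Fin n) ℂ) : Prop :=
  M * SymplecticPair.J n * Mᴴ = L * SymplecticPair.J n * Lᴴ

/-- `(A, B)` is a regular pair: `det (A - z B) ≠ 0` for some complex number `z`. -/
def IsRegularPair {ι : Type*} [Fintype ι] [DecidableEq ι] (A B : Matrix ι ι ℂ) : Prop :=
  ∃ z : ℂ, (A - z • B).det ≠ 0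

/-- `P A Q = C ⊕ I` and `P B Q = I ⊕ N` for some invertible `P`, `Q`, with `N` nilpotent
(`e` splits the index set into the two blocks). This is the Kronecker (Weierstrass) form of a
regular pair, except that `C` and `N` are not required to be Jordan matrices. Passing to Jordan
matrices only replaces `N` by a similar matrix, so the nilpotency index of `N` is the same. -/
def IsKroneckerForm {ι : Type*} [Fintype ι] [DecidableEq ι] (A B : Matrix ι ι ℂ) {p q : ℕ}
    (C : Matrix (Fin p) (Fin p) ℂ) (N : Matrix (Fin q) (Fin q) ℂ) : Prop :=
  IsNilpotent N ∧ ∃ (e : ι ≃ Fin p ⊕ Fin q) (P Q : Matrix ι ι ℂ), IsUnit P ∧ IsUnit Q ∧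
    Matrix.reindex e e (P * A * Q) = Matrix.fromBlocks C 0 0 1 ∧
    Matrix.reindex e e (P * B * Q) = Matrix.fromBlocks 1 0 0 N

/-- The index at infinity `ind_∞(A, B)` of a regular pair: the nilpotency index (the least `ν` with
`N ^ ν = 0`) of the block `N` of a Kronecker form. All Kronecker forms of a pair give the same
value, so the infimum only selects it. The value is `0` if `B` is invertible (`N` is then the
`0 × 0` matrix), and it is `⊤` for pairs without a Kronecker form, which are the non-regular ones. -/
noncomputable def indInf {ι : Type*} [Fintype ι] [DecidableEq ι] (A B : Matrix ι ι ℂ) : ℕ∞ :=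
  sInf {ν : ℕ∞ | ∃ (p q : ℕ) (C : Matrix (Fin p) (Fin p) ℂ) (N : Matrix (Fin q) (Fin q) ℂ),
    IsKroneckerForm A B C N ∧ ν = (nilpotencyClass N : ℕ∞)}

/-!
Since the index at infinity is at most one, the nilpotent block of the Kronecker form vanishes.
With `P⁻¹ = [P₁ | P₂]` and `Q⁻¹ = [R₁ ; R₂]`, the pair is `M = P₁ C R₁ + P₂ R₂`, `L = P₁ R₁`
(`exists_splitting_of_indInf_le_one`). In terms of the blocks `Kᵢⱼ = Rᵢ J Rⱼᴴ`, the identity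
`M J Mᴴ = L J Lᴴ` says `C K₁₁ Cᴴ = K₁₁`, `C K₁₂ = 0` and `K₂₂ = 0`.

Take `U₀ = J R₂ᴴ` and `U∞ = Q₂`. Then `M U₀ = 0`, `L U∞ = 0`, `U₀ᴴ J U₀ = K₂₂ = 0` and
`U₀ᴴ J U∞ = R₂ Q₂ = 1` are immediate. That `U∞` is isotropic follows because `C` is injective on
the range of `K₁₁` (`mul_eq_zero_of_congr_fixed`). So `Z = [U₀ | U∞]` is a hyperbolic system, and
by Witt cancellation (`exists_hyperbolic_complement`) its `J`-orthogonal complement has a basis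
`U₁` with `U₁ᴴ J U₁ = J`. Cancellation is where the signature of the skew-Hermitian form matters;
it is obtained from a Lagrangian subspace of the complement (`exists_isotropic_orthogonal`).

Finally, `R₂ U₁ = 0`, and `Y = R₁ U₁` satisfies `K₁₁ = Y J Yᴴ`, as follows from expressing `J`
through the basis `[U₁ | Z]` (`mul_J_mul_conjTranspose_add`). With a left inverse `Y'` of `Y`, the
identity `C K₁₁ Cᴴ = K₁₁` then makes `S = Y' C Y` symplectic with `C Y = Y S`, that is,
`M U₁ = L U₁ S`. The two ranks are bounded above by the kernel vectors `U₀`, `U∞`, and below by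
explicit left inverses.
-/

/-! ### The matrix `J` and its skew-Hermitian form -/

namespace SymplecticPair

lemma J_mul_J (n : ℕ) : J n * J n = -1 := by
  simp [J, Matrix.fromBlocks_multiply, ← Matrix.fromBlocks_one, Matrix.fromBlocks_neg]

lemma J_conjTranspose (n : ℕ) : (J n)ᴴ = -J n := by
  simp [J, Matrix.fromBlocks_conjTranspose, Matrix.fromBlocks_neg]

lemma J_mul_J_mul {n : ℕ} {ι : Type*} (A : Matrix (Fin n ⊕ Fin n) ι ℂ) :
    J n * (J n * A) = -A := by
  rw [← Matrix.mul_assoc, J_mul_J, Matrix.neg_mul, Matrix.one_mul]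

lemma fromCols_conj_J {n : ℕ} {ι κ : Type*} (A : Matrix (Fin n ⊕ Fin n) ι ℂ)
    (B : Matrix (Fin n ⊕ Fin n) κ ℂ) :
    (Matrix.fromCols A B)ᴴ * J n * Matrix.fromCols A B =
      Matrix.fromBlocks (Aᴴ * J n * A) (Aᴴ * J n * B) (Bᴴ * J n * A) (Bᴴ * J n * B) := by
  rw [Matrix.conjTranspose_fromCols_eq_fromRows_conjTranspose, Matrix.fromRows_mul,
    Matrix.fromRows_mul_fromCols]

lemma skew_swap {n : ℕ} {ι κ : Type*} (A : Matrix (Fin n ⊕ Fin n) ι ℂ)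
    (B : Matrix (Fin n ⊕ Fin n) κ ℂ) : (Aᴴ * J n * B)ᴴ = -(Bᴴ * J n * A) := by
  simp only [Matrix.conjTranspose_mul, Matrix.conjTranspose_conjTranspose, J_conjTranspose,
    Matrix.mul_assoc, Matrix.neg_mul, Matrix.mul_neg]

end SymplecticPair

open SymplecticPair

/-! ### One-sided inverses and ranks -/

lemma exists_left_inverse_of_linearIndependent_col {ι κ : Type*} [Fintype ι] [DecidableEq ι]
    [Fintype κ] [DecidableEq κ] {A : Matrix ι κ ℂ} (hA : LinearIndependent ℂ A.col) :
    ∃ B : Matrix κ ι ℂ, B * A = 1 := by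
  have hinj : LinearMap.ker (Matrix.toLin' A) = ⊥ :=
    LinearMap.ker_eq_bot.mpr (Matrix.mulVec_injective_iff.mpr hA)
  obtain ⟨g, hg⟩ := (Matrix.toLin' A).exists_leftInverse_of_injective hinj
  refine ⟨LinearMap.toMatrix' g, ?_⟩
  rw [← LinearMap.toMatrix'_toLin' A, ← LinearMap.toMatrix'_comp, hg, LinearMap.toMatrix'_id]

lemma card_le_rank_of_mul_mul_eq_one {ι κ : Type*} [Fintype ι] [Fintype κ] [DecidableEq κ]
    {A : Matrix κ ι ℂ} {M : Matrix ι ι ℂ} {B : Matrix ι κ ℂ} (h : A * M * B = 1) :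
    Fintype.card κ ≤ M.rank := by
  rw [← Matrix.rank_one (R := ℂ) (n := κ), ← h]
  exact (Matrix.rank_mul_le_left _ _).trans (Matrix.rank_mul_le_right _ _)

lemma rank_add_card_le_of_mul_eq_zero {ι κ : Type*} [Fintype ι] [Fintype κ] [DecidableEq κ]
    {M : Matrix ι ι ℂ} {U : Matrix ι κ ℂ} {V : Matrix κ ι ℂ} (hMU : M * U = 0) (hVU : V * U = 1) :
    M.rank + Fintype.card κ ≤ Fintype.card ι := by
  have h := Matrix.rank_add_rank_le_card_of_mul_eq_zero hMU
  have : Fintype.card κ ≤ U.rank := by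
    rw [← Matrix.rank_one (R := ℂ) (n := κ), ← hVU]
    exact Matrix.rank_mul_le_right _ _
  omega

/-- Comparing ranks in `K = C K Cᴴ` shows that `C` is injective on the range of `K`. -/
lemma mul_eq_zero_of_congr_fixed {ι κ : Type*} [Fintype ι] [Fintype κ] {C K : Matrix ι ι ℂ}
    (h : C * K * Cᴴ = K) {X : Matrix ι κ ℂ} (hX : C * K * X = 0) : K * X = 0 := by
  have hrank : (C * K).rank = K.rank :=
    le_antisymm (Matrix.rank_mul_le_right _ _) (by
      conv_lhs => rw [← h]
      exact Matrix.rank_mul_le_left _ _)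
  have hle : LinearMap.ker K.mulVecLin ≤ LinearMap.ker (C * K).mulVecLin := by
    rw [Matrix.mulVecLin_mul]
    exact LinearMap.ker_le_ker_comp _ _
  have hker : LinearMap.ker K.mulVecLin = LinearMap.ker (C * K).mulVecLin := by
    refine Submodule.eq_of_le_of_finrank_eq hle ?_
    have h1 := K.mulVecLin.finrank_range_add_finrank_ker
    have h2 := (C * K).mulVecLin.finrank_range_add_finrank_ker
    rw [Matrix.rank, Matrix.rank] at hrank
    omega
  ext i j
  have hj : X.col j ∈ LinearMap.ker (C * K).mulVecLin := by
    rw [LinearMap.mem_ker]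
    ext i
    exact congrFun (congrFun hX i) j
  rw [← hker, LinearMap.mem_ker] at hj
  exact congrFun hj i

/-! ### Witt cancellation -/

/-- `1 + Z J Zᴴ J` is the projection onto the `J`-orthogonal complement of `Z`,
provided `Zᴴ J Z = J`. The complement of `Z` means the vectors `x` with `Zᴴ J x = 0`. -/
def symplecticProj {n q : ℕ} (Z : Matrix (Fin n ⊕ Fin n) (Fin q ⊕ Fin q) ℂ) :
    Matrix (Fin n ⊕ Fin n) (Fin n ⊕ Fin n) ℂ :=
  1 + Z * J q * Zᴴ * J n

section Projection

variable {n q : ℕ} {Z : Matrix (Fin n ⊕ Fin n) (Fin q ⊕ Fin q) ℂ}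

lemma conjTranspose_mul_J_mul_symplecticProj (hZ : Zᴴ * J n * Z = J q) :
    Zᴴ * J n * symplecticProj Z = 0 := by
  have : Zᴴ * J n * symplecticProj Z = Zᴴ * J n + (Zᴴ * J n * Z) * J q * (Zᴴ * J n) := by
    simp only [symplecticProj, Matrix.mul_add, Matrix.mul_one, Matrix.mul_assoc]
  rw [this, hZ, J_mul_J, Matrix.neg_mul, Matrix.one_mul, add_neg_cancel]

lemma symplecticProj_mul {κ : Type*} (X : Matrix (Fin n ⊕ Fin n) κ ℂ) :
    symplecticProj Z * X = X + Z * J q * (Zᴴ * J n * X) := by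
  simp only [symplecticProj, Matrix.add_mul, Matrix.one_mul, Matrix.mul_assoc]

/-- How far projecting away from `Z` changes the form. -/
lemma conj_J_symplecticProj {κ κ' : Type*} (X : Matrix (Fin n ⊕ Fin n) κ ℂ)
    (hZ : Zᴴ * J n * Z = J q) (Y : Matrix (Fin n ⊕ Fin n) κ' ℂ) :
    (symplecticProj Z * X)ᴴ * J n * (symplecticProj Z * Y) =
      Xᴴ * J n * Y - (Zᴴ * J n * X)ᴴ * J q * (Zᴴ * J n * Y) := by
  have h1 : (symplecticProj Z * X)ᴴ * J n * (symplecticProj Z * Y) =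
      Xᴴ * J n * (symplecticProj Z * Y) +
        (Z * J q * (Zᴴ * J n * X))ᴴ * J n * (symplecticProj Z * Y) := by
    rw [symplecticProj_mul X, Matrix.conjTranspose_add, Matrix.add_mul, Matrix.add_mul]
  have h2 : (Z * J q * (Zᴴ * J n * X))ᴴ * J n * (symplecticProj Z * Y) = 0 := by
    have : (Z * J q * (Zᴴ * J n * X))ᴴ * J n * (symplecticProj Z * Y) =
        (Zᴴ * J n * X)ᴴ * (J q)ᴴ * (Zᴴ * J n * symplecticProj Z) * Y := by
      simp only [Matrix.conjTranspose_mul, Matrix.mul_assoc]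
    rw [this, conjTranspose_mul_J_mul_symplecticProj hZ, Matrix.mul_zero, Matrix.zero_mul]
  rw [h1, h2, add_zero, symplecticProj_mul, skew_swap]
  simp only [Matrix.mul_add, Matrix.mul_assoc, Matrix.neg_mul, sub_neg_eq_add]

end Projection

/-- Symplectic reduction of the Lagrangian subspace `{(x, 0)}`: those of its vectors which are
`J`-orthogonal to the first half of `Z` project to an isotropic subspace of the `J`-orthogonal
complement of `Z`, and this subspace has at least half the dimension of that complement. -/
lemma exists_isotropic_orthogonal {n q m : ℕ} (hn : n = m + q)
    {Z : Matrix (Fin n ⊕ Fin n) (Fin q ⊕ Fin q) ℂ} (hZ : Zᴴ * J n * Z = J q) :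
    ∃ A : Matrix (Fin n ⊕ Fin n) (Fin m) ℂ,
      LinearIndependent ℂ A.col ∧ Aᴴ * J n * A = 0 ∧ Zᴴ * J n * A = 0 := by
  set E : Matrix (Fin n ⊕ Fin n) (Fin n) ℂ := Matrix.fromRows 1 0 with hE
  set Z₀ := Z.toCols₁
  set Z₁ := Z.toCols₂
  have hZc : Z = Matrix.fromCols Z₀ Z₁ := (Matrix.fromCols_toCols Z).symm
  have hEE : Eᴴ * J n * E = 0 := by
    rw [hE, Matrix.conjTranspose_fromRows_eq_fromCols_conjTranspose, J,
      Matrix.fromCols_mul_fromBlocks, Matrix.fromCols_mul_fromRows]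
    simp
  have hEinj : Function.Injective E.mulVecLin := by
    intro x y hxy
    ext i
    simpa [hE, Matrix.fromRows_mulVec] using congrFun hxy (Sum.inl i)
  set N := Z₀ᴴ * J n * E with hN
  set f := (symplecticProj Z * E).mulVecLin
  set T := LinearMap.ker N.mulVecLin with hT
  have hZE {κ : Type} [Fintype κ] (X : Matrix (Fin n) κ ℂ) (hX : N * X = 0) :
      Zᴴ * J n * (E * X) = Matrix.fromRows 0 (Z₁ᴴ * J n * (E * X)) := by
    conv_lhs => rw [hZc]
    rw [Matrix.conjTranspose_fromCols_eq_fromRows_conjTranspose, Matrix.fromRows_mul,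
      Matrix.fromRows_mul, ← Matrix.mul_assoc (Z₀ᴴ * J n), ← hN, hX]
  -- a vector of `T` killed by the projection is `Z₀ c`, where `c` is `J`-orthogonal to `E`
  have hkey : (T ⊓ LinearMap.ker f).map E.mulVecLin ≤
      (LinearMap.ker Nᴴ.mulVecLin).map Z₀.mulVecLin := by
    rintro _ ⟨x, ⟨hxT, hxf⟩, rfl⟩
    set X : Matrix (Fin n) Unit ℂ := Matrix.replicateCol Unit x with hXdef
    have hNX : N * X = 0 := by
      rw [hXdef, ← Matrix.replicateCol_mulVec]
      have : N *ᵥ x = 0 := hxT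
      rw [this]; rfl
    have hfX : symplecticProj Z * (E * X) = 0 := by
      rw [hXdef, ← Matrix.mul_assoc, ← Matrix.replicateCol_mulVec]
      have : (symplecticProj Z * E) *ᵥ x = 0 := hxf
      rw [this]; rfl
    set c := Z₁ᴴ * J n * (E * X) with hc
    have hEX : E * X = -(Z₀ * c) := by
      rw [symplecticProj_mul, hZE X hNX, ← hc, hZc, J, Matrix.fromCols_mul_fromBlocks,
        Matrix.fromCols_mul_fromRows] at hfX
      simpa using eq_neg_of_add_eq_zero_left hfX
    have hNc : Nᴴ * c = 0 := by
      have : Eᴴ * J n * (Z₀ * c) = 0 := by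
        rw [← neg_neg (Z₀ * c), ← hEX, Matrix.mul_neg, ← Matrix.mul_assoc, hEE, Matrix.zero_mul,
          neg_zero]
      rw [hN, skew_swap, Matrix.neg_mul, Matrix.mul_assoc, this, neg_zero]
    refine ⟨-(c.col ()), ?_, ?_⟩
    · refine Submodule.neg_mem _ ?_
      rw [LinearMap.mem_ker]
      ext i
      exact congrFun (congrFun hNc i) ()
    · rw [map_neg]
      ext i
      exact (congrFun (congrFun hEX i) ()).symm
  have hdim : m ≤ Module.finrank ℂ (T.map f) := by
    have h1 := (f.domRestrict T).finrank_range_add_finrank_ker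
    rw [LinearMap.range_domRestrict, LinearMap.ker_domRestrict] at h1
    have h2 : Module.finrank ℂ ((LinearMap.ker f).comap T.subtype) =
        Module.finrank ℂ ((T ⊓ LinearMap.ker f).map E.mulVecLin) := by
      rw [← (Submodule.equivMapOfInjective _ hEinj _).finrank_eq,
        ← Submodule.map_comap_subtype,
        ← (Submodule.equivMapOfInjective _ T.injective_subtype _).finrank_eq]
    have h3 := Submodule.finrank_mono hkey
    have h4 := Submodule.finrank_map_le Z₀.mulVecLin (LinearMap.ker Nᴴ.mulVecLin)
    have h5 := N.mulVecLin.finrank_range_add_finrank_ker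
    have h6 := Nᴴ.mulVecLin.finrank_range_add_finrank_ker
    have h7 : Nᴴ.rank = N.rank := by
      open scoped ComplexOrder in exact Matrix.rank_conjTranspose N
    rw [Matrix.rank, Matrix.rank] at h7
    rw [Module.finrank_fin_fun] at h5 h6
    rw [← hT] at h5
    omega
  obtain ⟨g, hg⟩ := exists_linearIndependent_of_le_finrank hdim
  choose x hxT hx using fun i => (g i).2
  set X : Matrix (Fin n) (Fin m) ℂ := Matrix.of fun i j => x j i with hXdef
  have hNX : N * X = 0 := by
    ext i j
    exact congrFun (hxT j : N *ᵥ x j = 0) i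
  refine ⟨symplecticProj Z * (E * X), ?_, ?_, ?_⟩
  · have : (symplecticProj Z * (E * X)).col = fun i => (T.map f).subtype (g i) := by
      funext j
      rw [← Matrix.mul_assoc]
      exact hx j
    rw [this]
    exact hg.map' _ (Submodule.ker_subtype _)
  · have : (E * X)ᴴ * J n * (E * X) = Xᴴ * (Eᴴ * J n * E) * X := by
      simp only [Matrix.conjTranspose_mul, Matrix.mul_assoc]
    rw [conj_J_symplecticProj _ hZ, hZE X hNX, this, hEE,
      show J q = Matrix.fromBlocks 0 1 (-1) 0 from rfl,
      Matrix.conjTranspose_fromRows_eq_fromCols_conjTranspose, Matrix.fromCols_mul_fromBlocks,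
      Matrix.fromCols_mul_fromRows]
    simp
  · rw [← Matrix.mul_assoc, conjTranspose_mul_J_mul_symplecticProj hZ, Matrix.zero_mul]

/-- Witt cancellation: the `J`-orthogonal complement of a hyperbolic system `Z` is again
spanned by a hyperbolic system. -/
lemma exists_hyperbolic_complement {n q m : ℕ} (hn : n = m + q)
    {Z : Matrix (Fin n ⊕ Fin n) (Fin q ⊕ Fin q) ℂ} (hZ : Zᴴ * J n * Z = J q) :
    ∃ U : Matrix (Fin n ⊕ Fin n) (Fin m ⊕ Fin m) ℂ, Uᴴ * J n * U = J m ∧ Zᴴ * J n * U = 0 := by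
  obtain ⟨A, hA, hAA, hZA⟩ := exists_isotropic_orthogonal hn hZ
  obtain ⟨D, hD⟩ := exists_left_inverse_of_linearIndependent_col hA
  set B := symplecticProj Z * -(J n * Dᴴ) with hBdef
  have hZB : Zᴴ * J n * B = 0 := by
    rw [hBdef, ← Matrix.mul_assoc, conjTranspose_mul_J_mul_symplecticProj hZ, Matrix.zero_mul]
  have hAB : Aᴴ * J n * B = 1 := by
    have hPA : symplecticProj Z * A = A := by
      rw [symplecticProj_mul, hZA, Matrix.mul_zero, add_zero]
    have h := conj_J_symplecticProj A hZ (-(J n * Dᴴ))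
    rw [hPA, ← hBdef, hZA] at h
    rw [h, Matrix.mul_neg, Matrix.mul_assoc, J_mul_J_mul, Matrix.mul_neg, neg_neg,
      ← Matrix.conjTranspose_mul, hD]
    simp
  clear_value B
  set X := Bᴴ * J n * B with hX
  have hXX : Xᴴ = -X := skew_swap B B
  -- adding a multiple of `A` keeps the pairing with `A` and makes `B` isotropic
  set B' := B + A * ((1 / 2 : ℂ) • X) with hB'
  have hAB' : Aᴴ * J n * B' = 1 := by
    rw [hB', Matrix.mul_add, ← Matrix.mul_assoc, hAA, hAB, Matrix.zero_mul, add_zero]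
  have hB'A : B'ᴴ * J n * A = -1 := by
    rw [← neg_neg (B'ᴴ * J n * A), ← skew_swap, hAB', Matrix.conjTranspose_one]
  have hB'B' : B'ᴴ * J n * B' = 0 := by
    have h1 : B'ᴴ * J n * B' = B'ᴴ * J n * B + (B'ᴴ * J n * A) * ((1 / 2 : ℂ) • X) := by
      conv_lhs => rw [hB']
      rw [← hB', Matrix.mul_add, Matrix.mul_assoc _ A]
    have h2 : B'ᴴ * J n * B = X + ((1 / 2 : ℂ) • X)ᴴ * (Aᴴ * J n * B) := by
      rw [hB', Matrix.conjTranspose_add, Matrix.add_mul, Matrix.add_mul, Matrix.conjTranspose_mul,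
        ← hX, Matrix.mul_assoc _ Aᴴ, Matrix.mul_assoc _ (Aᴴ * J n)]
    rw [h1, h2, hB'A, hAB, Matrix.conjTranspose_smul, hXX]
    ext i j
    simp
    ring
  refine ⟨Matrix.fromCols A B', ?_, ?_⟩
  · rw [fromCols_conj_J, hAA, hAB', hB'A, hB'B', J]
  · rw [Matrix.mul_fromCols, hZA, hB', Matrix.mul_add, hZB, ← Matrix.mul_assoc, hZA]
    simp

/-! ### The Kronecker form of a pair of index at most one -/

/-- For a pair of index at most one, the Kronecker form splits the pair: with `P⁻¹ = [P₁ | P₂]`,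
`Q⁻¹ = [R₁ ; R₂]`, `P = [T₁ ; T₂]` and `Q = [Q₁ | Q₂]` one has `M = P₁ C R₁ + P₂ R₂` and
`L = P₁ R₁`, because the nilpotent block vanishes. -/
lemma exists_splitting_of_indInf_le_one {ι : Type*} [Fintype ι] [DecidableEq ι]
    {M L : Matrix ι ι ℂ} (h : indInf M L ≤ 1) :
    ∃ (p q : ℕ) (C : Matrix (Fin p) (Fin p) ℂ)
      (P₁ : Matrix ι (Fin p) ℂ) (P₂ : Matrix ι (Fin q) ℂ)
      (T₁ : Matrix (Fin p) ι ℂ) (T₂ : Matrix (Fin q) ι ℂ)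
      (Q₁ : Matrix ι (Fin p) ℂ) (Q₂ : Matrix ι (Fin q) ℂ)
      (R₁ : Matrix (Fin p) ι ℂ) (R₂ : Matrix (Fin q) ι ℂ),
      Fintype.card ι = p + q ∧
      Matrix.fromRows T₁ T₂ * Matrix.fromCols P₁ P₂ = 1 ∧
      Matrix.fromRows R₁ R₂ * Matrix.fromCols Q₁ Q₂ = 1 ∧
      Q₁ * R₁ + Q₂ * R₂ = 1 ∧
      M = P₁ * C * R₁ + P₂ * R₂ ∧ L = P₁ * R₁ := by
  have hne : {ν : ℕ∞ | ∃ (p q : ℕ) (C : Matrix (Fin p) (Fin p) ℂ) (N : Matrix (Fin q) (Fin q) ℂ),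
      IsKroneckerForm M L C N ∧ ν = (nilpotencyClass N : ℕ∞)}.Nonempty := by
    by_contra hne
    -- without a Kronecker form the infimum would be that of the empty set, which is `⊤`
    rw [Set.not_nonempty_iff_eq_empty] at hne
    rw [indInf, hne, sInf_empty] at h
    exact absurd h (by decide)
  obtain ⟨p, q, C, N, ⟨hN, e, P, Q, hP, hQ, hM, hL⟩, hν⟩ := csInf_mem hne
  have hN0 : N = 0 := by
    have h1 : nilpotencyClass N ≤ 1 := by
      have : (nilpotencyClass N : ℕ∞) ≤ 1 := hν ▸ h
      exact_mod_cast this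
    simpa using pow_eq_zero_of_le h1 (pow_nilpotencyClass hN)
  subst hN0
  obtain ⟨P, rfl⟩ := hP
  obtain ⟨Q, rfl⟩ := hQ
  set Pi : Matrix ι (Fin p ⊕ Fin q) ℂ := (↑P⁻¹ : Matrix ι ι ℂ).submatrix id e.symm with hPi
  set Pt : Matrix (Fin p ⊕ Fin q) ι ℂ := (↑P : Matrix ι ι ℂ).submatrix e.symm id with hPt
  set Qi : Matrix (Fin p ⊕ Fin q) ι ℂ := (↑Q⁻¹ : Matrix ι ι ℂ).submatrix e.symm id with hQi
  set Qt : Matrix ι (Fin p ⊕ Fin q) ℂ := (↑Q : Matrix ι ι ℂ).submatrix id e.symm with hQt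
  have hPP : Pt * Pi = 1 := by
    rw [hPt, hPi, ← Matrix.submatrix_mul _ _ _ _ _ Function.bijective_id, P.mul_inv]
    simp
  have hQQ : Qi * Qt = 1 := by
    rw [hQi, hQt, ← Matrix.submatrix_mul _ _ _ _ _ Function.bijective_id, Q.inv_mul]
    simp
  have hQQ' : Qt * Qi = 1 := by
    rw [hQi, hQt, ← Matrix.submatrix_mul _ _ _ _ _ e.symm.bijective, Q.mul_inv]
    simp
  have key (A : Matrix ι ι ℂ) (D : Matrix (Fin p ⊕ Fin q) (Fin p ⊕ Fin q) ℂ)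
      (hA : Matrix.reindex e e (P.val * A * Q.val) = D) : A = Pi * D * Qi := by
    rw [← hA, Matrix.reindex_apply, hPi, hQi,
      ← Matrix.submatrix_mul _ _ _ _ _ e.symm.bijective,
      ← Matrix.submatrix_mul _ _ _ _ _ e.symm.bijective, Matrix.submatrix_id_id,
      Matrix.mul_assoc, Matrix.mul_assoc, Matrix.mul_assoc, Q.mul_inv, Matrix.mul_one,
      ← Matrix.mul_assoc, P.inv_mul, Matrix.one_mul]
  have hPic := Matrix.fromCols_toCols Pi
  have hPtc := Matrix.fromRows_toRows Pt
  have hQic := Matrix.fromRows_toRows Qi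
  have hQtc := Matrix.fromCols_toCols Qt
  refine ⟨p, q, C, Pi.toCols₁, Pi.toCols₂, Pt.toRows₁, Pt.toRows₂, Qt.toCols₁, Qt.toCols₂,
    Qi.toRows₁, Qi.toRows₂, ?_, ?_, ?_, ?_, ?_, ?_⟩
  · simpa using Fintype.card_congr e
  · rw [hPic, hPtc, hPP]
  · rw [hQic, hQtc, hQQ]
  · rw [← Matrix.fromCols_mul_fromRows, hQic, hQtc, hQQ']
  · conv_lhs => rw [key M _ hM, ← hPic, ← hQic, Matrix.fromCols_mul_fromBlocks,
      Matrix.fromCols_mul_fromRows]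
    simp
  · conv_lhs => rw [key L _ hL, ← hPic, ← hQic, Matrix.fromCols_mul_fromBlocks,
      Matrix.fromCols_mul_fromRows]
    simp

/-! ### Canonical form of a symplectic pair -/

/-- A hyperbolic system `[U | Z]` of full size is a basis, which expresses `J` through it. -/
lemma mul_J_mul_conjTranspose_add {n q m : ℕ} (hn : n = m + q)
    {Z : Matrix (Fin n ⊕ Fin n) (Fin q ⊕ Fin q) ℂ} (hZ : Zᴴ * J n * Z = J q)
    {U : Matrix (Fin n ⊕ Fin n) (Fin m ⊕ Fin m) ℂ} (hU : Uᴴ * J n * U = J m)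
    (hZU : Zᴴ * J n * U = 0) : U * J m * Uᴴ + Z * J q * Zᴴ = J n := by
  have hUZ : Uᴴ * J n * Z = 0 := by
    rw [← neg_neg (Uᴴ * J n * Z), ← skew_swap, hZU]; simp
  have h1 : Matrix.fromRows (-(J m * (Uᴴ * J n))) (-(J q * (Zᴴ * J n))) * Matrix.fromCols U Z
      = 1 := by
    rw [Matrix.fromRows_mul_fromCols]
    simp only [Matrix.neg_mul, Matrix.mul_assoc (J m), Matrix.mul_assoc (J q), hU, hZ, hUZ, hZU,
      J_mul_J, Matrix.mul_zero, neg_neg, neg_zero, Matrix.fromBlocks_one]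
  rw [Matrix.mul_eq_one_comm_of_card_eq _ _ _ (by simp; omega), Matrix.fromCols_mul_fromRows] at h1
  have h2 : U * J m * Uᴴ + Z * J q * Zᴴ =
      (U * -(J m * (Uᴴ * J n)) + Z * -(J q * (Zᴴ * J n))) * J n := by
    simp only [Matrix.add_mul, Matrix.mul_neg, Matrix.neg_mul, Matrix.mul_assoc, J_mul_J,
      Matrix.mul_one, neg_neg]
  rw [h2, h1, Matrix.one_mul]

theorem theorem2p3 (n : ℕ) (M L : Matrix (Fin n ⊕ Fin n) (Fin n ⊕ Fin n) ℂ)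
    (hreg : IsRegularPair M L) (hsymp : IsSymplecticPair M L) (hind : indInf M L ≤ 1) :
    ∃ nHat : ℕ, nHat ≤ n ∧ M.rank = n + nHat ∧ L.rank = n + nHat ∧
      ∃ (U₀ Uinf : Matrix (Fin n ⊕ Fin n) (Fin (n - nHat)) ℂ)
        (U₁ : Matrix (Fin n ⊕ Fin n) (Fin nHat ⊕ Fin nHat) ℂ)
        (SHat : Matrix (Fin nHat ⊕ Fin nHat) (Fin nHat ⊕ Fin nHat) ℂ),
        IsSymplecticMatrix SHat ∧
        (Matrix.fromCols U₁ (Matrix.fromCols U₀ Uinf))ᴴ * SymplecticPair.J n *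
            Matrix.fromCols U₁ (Matrix.fromCols U₀ Uinf) =
          Matrix.fromBlocks (SymplecticPair.J nHat) 0 0 (SymplecticPair.J (n - nHat)) ∧
        M * U₀ = 0 ∧ L * Uinf = 0 ∧ M * U₁ = L * U₁ * SHat := by
  obtain ⟨p, q, C, P₁, P₂, T₁, T₂, Q₁, Q₂, R₁, R₂, hcard, hTP, hRQ, hQR, hM, hL⟩ :=
    exists_splitting_of_indInf_le_one hind
  rw [Matrix.fromRows_mul_fromCols, ← Matrix.fromBlocks_one, Matrix.fromBlocks_inj] at hTP hRQ
  obtain ⟨hT₁P₁, hT₁P₂, hT₂P₁, hT₂P₂⟩ := hTP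
  obtain ⟨hR₁Q₁, hR₁Q₂, hR₂Q₁, hR₂Q₂⟩ := hRQ
  -- multiplying by the rows of `P` isolates the blocks of `M` and `L`
  have hT₁M : T₁ * M = C * R₁ := by
    rw [hM, Matrix.mul_add, ← Matrix.mul_assoc, ← Matrix.mul_assoc, ← Matrix.mul_assoc, hT₁P₁,
      hT₁P₂, Matrix.one_mul, Matrix.zero_mul, add_zero]
  have hT₂M : T₂ * M = R₂ := by
    rw [hM, Matrix.mul_add, ← Matrix.mul_assoc, ← Matrix.mul_assoc, ← Matrix.mul_assoc, hT₂P₁,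
      hT₂P₂, Matrix.one_mul, Matrix.zero_mul, Matrix.zero_mul, zero_add]
  have hT₁L : T₁ * L = R₁ := by rw [hL, ← Matrix.mul_assoc, hT₁P₁, Matrix.one_mul]
  have hT₂L : T₂ * L = 0 := by rw [hL, ← Matrix.mul_assoc, hT₂P₁, Matrix.zero_mul]
  have hpair {a b : ℕ} (A : Matrix (Fin a) (Fin n ⊕ Fin n) ℂ)
      (B : Matrix (Fin b) (Fin n ⊕ Fin n) ℂ) :
      (A * M) * J n * (B * M)ᴴ = (A * L) * J n * (B * L)ᴴ := by
    have h (X : Matrix (Fin n ⊕ Fin n) (Fin n ⊕ Fin n) ℂ) :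
        (A * X) * J n * (B * X)ᴴ = A * (X * J n * Xᴴ) * Bᴴ := by
      simp only [Matrix.conjTranspose_mul, Matrix.mul_assoc]
    rw [h, h, hsymp]
  -- the blocks of `Q⁻¹ J Q⁻ᴴ`
  have hK₁₁ : C * (R₁ * J n * R₁ᴴ) * Cᴴ = R₁ * J n * R₁ᴴ := by
    have h := hpair T₁ T₁
    rw [hT₁M, hT₁L] at h
    refine Eq.trans ?_ h
    simp only [Matrix.conjTranspose_mul, Matrix.mul_assoc]
  have hK₁₂ : C * (R₁ * J n * R₂ᴴ) = 0 := by
    have h := hpair T₁ T₂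
    rw [hT₁M, hT₂M, hT₂L, Matrix.conjTranspose_zero, Matrix.mul_zero] at h
    rw [← h]
    simp only [Matrix.mul_assoc]
  have hK₂₂ : R₂ * J n * R₂ᴴ = 0 := by
    have h := hpair T₂ T₂
    rwa [hT₂M, hT₂L, Matrix.zero_mul, Matrix.zero_mul] at h
  set U₀ := J n * R₂ᴴ with hU₀
  have hU₀J : U₀ᴴ * J n = R₂ := by
    rw [hU₀, Matrix.conjTranspose_mul, J_conjTranspose, Matrix.conjTranspose_conjTranspose,
      Matrix.mul_assoc, Matrix.neg_mul, J_mul_J, neg_neg, Matrix.mul_one]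
  have hMU₀ : M * U₀ = 0 := by
    rw [hM, hU₀, Matrix.add_mul, Matrix.mul_assoc P₁, Matrix.mul_assoc P₁, Matrix.mul_assoc C,
      Matrix.mul_assoc P₂, ← Matrix.mul_assoc R₁, ← Matrix.mul_assoc R₂, hK₁₂, hK₂₂,
      Matrix.mul_zero, Matrix.mul_zero, add_zero]
  have hLQ₂ : L * Q₂ = 0 := by rw [hL, Matrix.mul_assoc, hR₁Q₂, Matrix.mul_zero]
  have hU₀Q₂ : U₀ᴴ * J n * Q₂ = 1 := by rw [hU₀J, hR₂Q₂]
  have hQ₂U₀ : Q₂ᴴ * J n * U₀ = -1 := by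
    rw [← neg_neg (Q₂ᴴ * J n * U₀), ← skew_swap, hU₀Q₂, Matrix.conjTranspose_one]
  have hU₀U₀ : U₀ᴴ * J n * U₀ = 0 := by rw [hU₀J, hU₀, ← Matrix.mul_assoc, hK₂₂]
  -- the resolution of the identity, for inserting between two factors
  have hins {κ : Type} (X : Matrix (Fin n ⊕ Fin n) κ ℂ) :
      X = R₁ᴴ * (Q₁ᴴ * X) + R₂ᴴ * (Q₂ᴴ * X) := by
    conv_lhs => rw [← Matrix.one_mul X, ← Matrix.conjTranspose_one, ← hQR]
    simp only [Matrix.conjTranspose_add, Matrix.conjTranspose_mul, Matrix.add_mul,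
      Matrix.mul_assoc]
  have hQ₂Q₂ : Q₂ᴴ * J n * Q₂ = 0 := by
    have h0 : R₁ * J n * R₁ᴴ * (Q₁ᴴ * (J n * Q₂)) + R₁ * J n * R₂ᴴ * (Q₂ᴴ * (J n * Q₂)) = 0 := by
      have h := congrArg (fun X => R₁ * J n * X) (hins (J n * Q₂))
      simp only [Matrix.mul_add, ← Matrix.mul_assoc] at h ⊢
      rw [← h, Matrix.mul_assoc R₁, J_mul_J, Matrix.mul_neg, Matrix.mul_one, Matrix.neg_mul, hR₁Q₂,
        neg_zero]
    have h1 : R₁ * J n * R₁ᴴ * (Q₁ᴴ * (J n * Q₂)) = 0 := by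
      refine mul_eq_zero_of_congr_fixed hK₁₁ ?_
      have h := congrArg (fun X => C * X) h0
      simp only [Matrix.mul_add, Matrix.mul_zero] at h
      rwa [← Matrix.mul_assoc C, ← Matrix.mul_assoc C (R₁ * J n * R₂ᴴ), hK₁₂, Matrix.zero_mul,
        add_zero] at h
    rw [h1, zero_add] at h0
    -- `R₁ J R₂ᴴ` has the left inverse `-(Q₂ᴴ J Q₁)`
    have h2 : Q₂ᴴ * J n * Q₁ * (R₁ * J n * R₂ᴴ) = -1 := by
      have h3 : Q₂ᴴ * J n * Q₁ * (R₁ * J n * R₂ᴴ) =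
          Q₂ᴴ * J n * (1 - Q₂ * R₂) * U₀ := by
        rw [← hQR, add_sub_cancel_right, hU₀]
        simp only [Matrix.mul_assoc]
      rw [h3, Matrix.mul_sub, Matrix.mul_one, Matrix.sub_mul, hQ₂U₀, Matrix.mul_assoc,
        Matrix.mul_assoc Q₂, hU₀, ← Matrix.mul_assoc R₂, hK₂₂]
      simp
    have h3 := congrArg (fun X => Q₂ᴴ * J n * Q₁ * X) h0
    simp only [Matrix.mul_zero] at h3
    rw [← Matrix.mul_assoc, h2, Matrix.neg_mul, Matrix.one_mul, neg_eq_zero] at h3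
    rwa [Matrix.mul_assoc]
  set Z := Matrix.fromCols U₀ Q₂ with hZdef
  have hZ : Zᴴ * J n * Z = J q := by
    rw [hZdef, fromCols_conj_J, hU₀U₀, hU₀Q₂, hQ₂U₀, hQ₂Q₂, J]
  have hcard' : n + n = p + q := by simpa using hcard
  have hqn : q ≤ n := by
    -- `Z` has a left inverse, so its `2 q` columns are independent
    have h : (-(J q * (Zᴴ * J n))) * Z = 1 := by
      rw [Matrix.neg_mul, Matrix.mul_assoc, hZ, J_mul_J, neg_neg]
    have h' := card_le_rank_of_mul_mul_eq_one (M := (1 : Matrix (Fin n ⊕ Fin n) _ ℂ))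
      (A := -(J q * (Zᴴ * J n))) (B := Z)
      (by rw [Matrix.mul_one]; exact h)
    simp only [Matrix.rank_one, Fintype.card_sum, Fintype.card_fin] at h'
    omega
  obtain ⟨m, hn⟩ : ∃ m, n = m + q := ⟨n - q, by omega⟩
  obtain ⟨U₁, hU₁, hZU₁⟩ := exists_hyperbolic_complement hn hZ
  have hU₁Z : U₁ᴴ * J n * Z = 0 := by
    rw [← neg_neg (U₁ᴴ * J n * Z), ← skew_swap, hZU₁]; simp
  have hR₂U₁ : R₂ * U₁ = 0 := by
    rw [hZdef, Matrix.conjTranspose_fromCols_eq_fromRows_conjTranspose, Matrix.fromRows_mul,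
      Matrix.fromRows_mul, hU₀J, ← Matrix.fromRows_zero] at hZU₁
    exact (Matrix.fromRows_inj.eq_iff.mp hZU₁).1
  set Y := R₁ * U₁ with hY
  have hQ₁Y : Q₁ * Y = U₁ := by
    conv_rhs => rw [← Matrix.one_mul U₁, ← hQR, Matrix.add_mul, Matrix.mul_assoc, Matrix.mul_assoc,
      hR₂U₁, Matrix.mul_zero, add_zero]
  have hKY : R₁ * J n * R₁ᴴ = Y * J m * Yᴴ := by
    have hRZ : R₁ * Z = Matrix.fromCols (R₁ * U₀) 0 := by
      rw [hZdef, Matrix.mul_fromCols, hR₁Q₂]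
    have h0 : R₁ * Z * J q * (R₁ * Z)ᴴ = 0 := by
      rw [hRZ, J, Matrix.conjTranspose_fromCols_eq_fromRows_conjTranspose,
        Matrix.fromCols_mul_fromBlocks, Matrix.fromCols_mul_fromRows]
      simp
    rw [← mul_J_mul_conjTranspose_add hn hZ hU₁ hZU₁, ← add_zero (Y * J m * Yᴴ), ← h0, hY]
    simp only [Matrix.mul_add, Matrix.add_mul, Matrix.conjTranspose_mul, Matrix.mul_assoc]
  set Y' := -(J m * (U₁ᴴ * J n * Q₁)) with hY'
  have hY'Y : Y' * Y = 1 := by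
    rw [hY', Matrix.neg_mul, Matrix.mul_assoc, Matrix.mul_assoc _ Q₁, hQ₁Y, hU₁, J_mul_J, neg_neg]
  -- `T` is the inverse that `S` must have, read off from `C (Y J Yᴴ) Cᴴ = Y J Yᴴ`
  set S := Y' * C * Y with hS
  set T := J m * (C * Y)ᴴ * Y'ᴴ * -J m with hT
  have hCYT : C * Y * T = Y := by
    have h : C * Y * T = C * (Y * J m * Yᴴ) * Cᴴ * Y'ᴴ * -J m := by
      rw [hT]
      simp only [Matrix.conjTranspose_mul, Matrix.mul_assoc]
    rw [h, ← hKY, hK₁₁, hKY, Matrix.mul_assoc _ Yᴴ, ← Matrix.conjTranspose_mul, hY'Y,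
      Matrix.conjTranspose_one, Matrix.mul_one, Matrix.mul_assoc, Matrix.mul_neg, J_mul_J, neg_neg,
      Matrix.mul_one]
  have hST : S * T = 1 := by
    rw [hS, Matrix.mul_assoc Y', Matrix.mul_assoc Y', hCYT, hY'Y]
  have hCY : C * Y = Y * S := by
    conv_rhs => rw [← hCYT, Matrix.mul_assoc, mul_eq_one_comm.mp hST, Matrix.mul_one]
  have hSsymp : IsSymplecticMatrix S := by
    have h : S * J m * Sᴴ = Y' * (C * (Y * J m * Yᴴ) * Cᴴ) * Y'ᴴ := by
      rw [hS]
      simp only [Matrix.conjTranspose_mul, Matrix.mul_assoc]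
    have h' : Y' * (Y * J m * Yᴴ) * Y'ᴴ = (Y' * Y) * J m * (Y' * Y)ᴴ := by
      simp only [Matrix.conjTranspose_mul, Matrix.mul_assoc]
    rw [IsSymplecticMatrix, h, ← hKY, hK₁₁, hKY, h', hY'Y]
    simp
  have hMU₁ : M * U₁ = L * U₁ * S := by
    rw [hM, hL, Matrix.add_mul, Matrix.mul_assoc P₂, hR₂U₁, Matrix.mul_zero, add_zero,
      Matrix.mul_assoc, ← hY, Matrix.mul_assoc P₁, hCY, Matrix.mul_assoc P₁ R₁, ← hY,
      Matrix.mul_assoc P₁]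
  have hMle := rank_add_card_le_of_mul_eq_zero hMU₀
    (V := -(Q₂ᴴ * J n)) (by rw [Matrix.neg_mul, hQ₂U₀, neg_neg])
  have hLle := rank_add_card_le_of_mul_eq_zero hLQ₂ hR₂Q₂
  have hleL : Fintype.card (Fin p) ≤ L.rank :=
    card_le_rank_of_mul_mul_eq_one (A := T₁) (B := Q₁) (by rw [hT₁L, hR₁Q₁])
  have hleM : Fintype.card ((Fin m ⊕ Fin m) ⊕ Fin q) ≤ M.rank := by
    refine card_le_rank_of_mul_mul_eq_one (A := Matrix.fromRows (Y' * T₁) T₂)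
      (B := Matrix.fromCols (U₁ * T) Q₂) ?_
    rw [Matrix.fromRows_mul, Matrix.mul_assoc, hT₁M, hT₂M, Matrix.fromRows_mul_fromCols,
      ← Matrix.mul_assoc R₂, hR₂U₁, hR₂Q₂, Matrix.zero_mul, Matrix.mul_assoc Y', Matrix.mul_assoc C,
      ← Matrix.mul_assoc R₁, ← hY, ← Matrix.mul_assoc C, hCYT, hY'Y, Matrix.mul_assoc Y',
      Matrix.mul_assoc C, hR₁Q₂, Matrix.mul_zero, Matrix.mul_zero, Matrix.fromBlocks_one]
  simp only [Fintype.card_sum, Fintype.card_fin] at hMle hLle hleL hleM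
  have hU : (Matrix.fromCols U₁ Z)ᴴ * J n * Matrix.fromCols U₁ Z =
      Matrix.fromBlocks (J m) 0 0 (J q) := by
    rw [fromCols_conj_J, hU₁, hU₁Z, hZU₁, hZ]
  obtain rfl : q = n - m := by omega
  exact ⟨m, by omega, by omega, by omega, U₀, Q₂, U₁, S, hSsymp, hU, hMU₀, hLQ₂, hMU₁⟩
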